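/- Let $q$ be an odd prime power and $\mathbb{F}_q$ the finite field with $q$ elements. For $r\in\mathbb{F}_q^*$ and an integer $m$, let $N_r(m,q)$ be the number of $m$-tuples $(a_1,\ldots,a_m)\in\mathbb{F}_q^m$ such that all $m(m-1)/2$ shifted products $a_ia_j+r$, $1\le i<j\le m$, are squares in $\mathbb{F}_q$ (where $0$ counts as a square). Then for every fixed $m\ge 4$, uniformly over all odd prime powers $q$ and all $r\in\mathbb{F}_q^*$, $$N_r(m,q)=2^{-m(m-1)/2}q^m+O\left(q^{m-1}\right),$$ that is, for every integer $m\ge 4$ there is a constant $C$, depending only on $m$, such that for all odd prime powers $q$ and all $r\in\mathbb{F}_q^*$, $$\left|N_r(m,q)-2^{-m(m-1)/2}q^m\right|\le C\,q^{m-1}.$$ -/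

import Mathlib

/-- `a = (a₁, …, aₘ) ∈ Fᵐ` is a Diophantine `m`-tuple in `F` with shift `r`: all the shifted
products `aᵢ aⱼ + r` with `i < j` are perfect squares in `F` (zero being a square). -/
def IsDiophantineTuple {F : Type*} [Field F] {m : ℕ} (r : F) (a : Fin m → F) : Prop :=
  ∀ i j : Fin m, i < j → IsSquare (a i * a j + r)

/-- The number of Diophantine `m`-tuples in `F` with shift `r` (a finite number when `F` is a
finite field). -/
noncomputable def numDiophantineTuples {F : Type*} [Field F] (r : F) (m : ℕ) : ℕ :=
  {a : Fin m → F | IsDiophantineTuple r a}.ncard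

/-!
Expanding the indicator of "`a i * a j + r` is a square" as `(1 + χ) / 2`, with `χ` the quadratic
character, turns the count into a sum over the graphs `E` on `m` vertices of the character sums
`∑ₐ ∏_{(i, j) ∈ E} χ (a i * a j + r)`, up to `O(q ^ (m - 1))` tuples where some `a i * a j + r`
vanishes. The empty graph gives the main term `q ^ m`, so each nonempty graph has to be shown to
contribute only `O(q ^ (m - 1))` (`card_mul_abs_sum_edgeProd_le`). Summing over one variable by
Weil's bound would save only `√q`; the point is to save `√q` twice.

For a single edge this is orthogonality. Otherwise some vertex `v` lies on one edge and not on
another. The substitution `a u ↦ t * a u` for `u ≠ v`, `a v ↦ a v / t` leaves the product over the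
edges at `v` unchanged and dilates the arguments of the other edges. Averaging over `t` and over
`a v` therefore bounds the sum by `q ^ (-2)` times the inner product of two functions of the tuple:

* `T`, the sum over `a v` of the product over the edges at `v`. Its mean square is `O(q)` by the
  near-orthogonality of the functions `y ↦ χ (x * y + r)`
  (`card_mul_sum_sq_sum_edgeProd_le`).
* `B`, the sum over `t` of the product over the other edges, with `t * a` in place of `a`. This is
  the sum of `χ` over the values of the polynomial `∏ (a i * a j * X ^ 2 + r)`, which for all but
  `O(q ^ (m - 1))` tuples has a simple factor; so its mean square is `O(q)` too, by Weil's bound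
  (`card_mul_sum_sq_sum_edgeProd_smul_le`).

The Cauchy–Schwarz inequality then gives `O(q ^ (m - 1))`.

Weil's bound for `∑ χ (f x)`, with a constant depending only on `deg f`
(`sq_sum_quadraticChar_eval_le`), is proved by Stepanov's method: linear algebra produces a nonzero
polynomial `∑ⱼ X ^ (j q) (f ^ l rⱼ + f ^ (l + c) sⱼ)`, `c = (q - 1) / 2`, of small degree, that
vanishes to order `l ≈ √q` wherever `f ^ c` takes a given value `±1`. Hasse derivatives express
the order of vanishing, as `l` may exceed the characteristic.
-/

section Stepanov

open Polynomial

/-! ### Hasse derivatives and vanishing order -/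

theorem pow_sub_dvd_hasseDeriv_pow {R : Type*} [CommRing R] (f : R[X]) (N k : ℕ) :
    f ^ (N - k) ∣ hasseDeriv k (f ^ N) := by
  induction N generalizing k with
  | zero => simp
  | succ N ih =>
    rw [pow_succ', hasseDeriv_mul]
    refine Finset.dvd_sum fun ij hij => ?_
    rw [Finset.HasAntidiagonal.mem_antidiagonal] at hij
    rcases Nat.eq_zero_or_pos ij.1 with h0 | h0
    · have hk : ij.2 = k := by omega
      rw [h0, hk, hasseDeriv_zero']
      refine (pow_dvd_pow f (show N + 1 - k ≤ (N - k) + 1 by omega)).trans ?_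
      rw [pow_succ']
      exact mul_dvd_mul_left f (ih k)
    · exact ((pow_dvd_pow f (by omega)).trans (ih ij.2)).mul_left _

/-- For `k ≤ N`, the `k`-th Hasse derivative of `f ^ N * r` is `f ^ (N - k)` times a polynomial
that depends linearly on `r` and whose degree exceeds that of `r` by at most `k * deg f`. -/
theorem exists_hasseDeriv_pow_mul {K : Type*} [Field K] {f : K[X]} (hf : f ≠ 0) {N k : ℕ}
    (hk : k ≤ N) :
    ∃ L : K[X] →ₗ[K] K[X], ∀ r, hasseDeriv k (f ^ N * r) = f ^ (N - k) * L r ∧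
      (L r).natDegree ≤ r.natDegree + k * f.natDegree := by
  choose g hg using fun i => pow_sub_dvd_hasseDeriv_pow f N i
  have hdeg : ∀ i ≤ N, (g i).natDegree ≤ i * f.natDegree := by
    intro i hi
    by_cases h0 : g i = 0
    · simp [h0]
    have h1 := natDegree_hasseDeriv_le (f ^ N) i
    rw [hg i, natDegree_mul (pow_ne_zero _ hf) h0, natDegree_pow, natDegree_pow] at h1
    have h2 : (N - i) * f.natDegree + i * f.natDegree = N * f.natDegree := by
      rw [← add_mul, Nat.sub_add_cancel hi]
    omega
  refine ⟨∑ ij ∈ Finset.HasAntidiagonal.antidiagonal k,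
    (LinearMap.mulLeft K (f ^ ij.2 * g ij.1)).comp (hasseDeriv ij.2), fun r => ⟨?_, ?_⟩⟩
  · rw [hasseDeriv_mul, LinearMap.sum_apply, Finset.mul_sum]
    refine Finset.sum_congr rfl fun ij hij => ?_
    rw [Finset.HasAntidiagonal.mem_antidiagonal] at hij
    have h : N - ij.1 = (N - k) + ij.2 := by omega
    rw [hg, h, pow_add]
    simp only [LinearMap.comp_apply, LinearMap.mulLeft_apply]
    ring
  · rw [LinearMap.sum_apply]
    refine natDegree_sum_le_of_forall_le _ _ fun ij hij => ?_
    rw [Finset.HasAntidiagonal.mem_antidiagonal] at hij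
    simp only [LinearMap.comp_apply, LinearMap.mulLeft_apply]
    have h1 : (f ^ ij.2 * g ij.1 * hasseDeriv ij.2 r).natDegree
        ≤ (ij.2 * f.natDegree + ij.1 * f.natDegree) + r.natDegree := by
      refine natDegree_mul_le_of_le (natDegree_mul_le_of_le ?_ (hdeg _ (by omega))) ?_
      · exact (natDegree_pow _ _).le
      · exact (natDegree_hasseDeriv_le _ _).trans (Nat.sub_le _ _)
    refine h1.trans ?_
    rw [← hij]
    apply le_of_eq
    ring

/-- Hasse derivatives of order less than `q` treat `q`-th powers as constants. -/
theorem hasseDeriv_X_pow_card_mul {K : Type*} [Field K] [Fintype K] (j : ℕ) {k : ℕ}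
    (hk : k < Fintype.card K) (g : K[X]) :
    hasseDeriv k (X ^ (j * Fintype.card K) * g) = X ^ (j * Fintype.card K) * hasseDeriv k g := by
  have hchoose : ∀ i, 0 < i → i ≤ k → ((j * Fintype.card K).choose i : K) = 0 := by
    intro i hi hik
    rw [← coeff_one_add_X_pow, pow_mul, ← FiniteField.expand_card,
      coeff_expand Fintype.card_pos, if_neg]
    exact fun h => absurd (Nat.le_of_dvd hi h) (by omega)
  rw [hasseDeriv_mul, Finset.sum_eq_single (0, k)]
  · rw [hasseDeriv_zero']
  · rintro ⟨i, l⟩ hil hne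
    rw [Finset.HasAntidiagonal.mem_antidiagonal] at hil
    have hi : 0 < i := by
      rcases Nat.eq_zero_or_pos i with h | h
      · exact absurd (by simp_all) hne
      · exact h
    rw [← monomial_one_right_eq_X_pow, hasseDeriv_monomial,
      hchoose i hi (by simp only at hil; omega)]
    simp
  · simp

theorem X_sub_C_pow_dvd_of_hasseDeriv_eval {K : Type*} [Field K] {P : K[X]} {l : ℕ} {x : K}
    (h : ∀ k < l, (hasseDeriv k P).eval x = 0) : (X - C x) ^ l ∣ P := by
  have h1 : X ^ l ∣ taylor x P := by
    rw [X_pow_dvd_iff]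
    intro k hk
    rw [taylor_coeff]
    exact h k hk
  obtain ⟨g, hg⟩ := h1
  refine ⟨taylor (-x) g, ?_⟩
  have h2 := congrArg (taylor (-x)) hg
  rw [taylor_taylor, taylor_mul, taylor_pow, taylor_X] at h2
  simpa [sub_eq_add_neg] using h2

theorem card_mul_le_natDegree_of_hasseDeriv_eval {K : Type*} [Field K] {P : K[X]} (hP : P ≠ 0)
    {l : ℕ} (Z : Finset K) (h : ∀ x ∈ Z, ∀ k < l, (hasseDeriv k P).eval x = 0) :
    Z.card * l ≤ P.natDegree := by
  have h1 : ∏ x ∈ Z, (X - C x) ^ l ∣ P := by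
    refine Finset.prod_dvd_of_coprime (fun x _ y _ hxy => ?_)
      (fun x hx => X_sub_C_pow_dvd_of_hasseDeriv_eval (h x hx))
    exact (pairwise_coprime_X_sub_C Function.injective_id hxy).pow
  have h2 := natDegree_le_of_dvd h1 hP
  rw [natDegree_prod_of_monic _ _ fun x _ => (monic_X_sub_C x).pow l] at h2
  simpa using h2

/-! ### Stepanov's auxiliary polynomial -/

/-- If `π` divides `f` exactly once, then `r² f = c s²` forces `s = 0`, by comparing the parities
of the multiplicities of `π`. -/
theorem eq_zero_of_sq_mul_eq {K : Type*} [Field K] {f p : K[X]} (hp : Prime p) (hpf : p ∣ f)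
    (hpf2 : ¬ p ^ 2 ∣ f) {c : K} (hc : c ≠ 0) {r s : K[X]} (h : r ^ 2 * f = C c * s ^ 2) :
    s = 0 := by
  by_contra hs
  have hf1 : emultiplicity p f = 1 := by
    have := (emultiplicity_eq_coe (a := p) (b := f) (n := 1)).2 ⟨by simpa using hpf, hpf2⟩
    simpa using this
  have hu : IsUnit (C c : K[X]) := isUnit_C.2 (isUnit_iff_ne_zero.2 hc)
  have hr : r ≠ 0 := by
    rintro rfl
    rw [zero_pow two_ne_zero, zero_mul, eq_comm, mul_eq_zero] at h
    rcases h with h | h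
    · exact hc (C_eq_zero.1 h)
    · exact hs (pow_eq_zero_iff two_ne_zero |>.1 h)
  have fin : ∀ g : K[X], g ≠ 0 → ∃ n : ℕ, emultiplicity p g = n := fun g hg =>
    ⟨_, (FiniteMultiplicity.of_prime_left hp hg).emultiplicity_eq_multiplicity⟩
  obtain ⟨a, ha⟩ := fin r hr
  obtain ⟨b, hb⟩ := fin s hs
  have h1 := congrArg (emultiplicity p) h
  rw [emultiplicity_mul hp, emultiplicity_mul hp, emultiplicity_pow hp, emultiplicity_pow hp,
    ha, hb, hf1, emultiplicity_eq_zero.2 (fun hd => hp.not_isUnit (isUnit_of_dvd_unit hd hu))] at h1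
  norm_cast at h1
  omega

/-- The nonvanishing of Stepanov's auxiliary polynomial: modulo `X ^ q`, a relation
`r + s f ^ ((q - 1) / 2) = 0` gives `r² f = f(0) s²`, as `f ^ q = f(X ^ q)`. -/
theorem eq_zero_of_X_pow_card_dvd {K : Type*} [Field K] [Fintype K] {f p : K[X]} (hp : Prime p)
    (hpf : p ∣ f) (hpf2 : ¬ p ^ 2 ∣ f) (hf0 : f.eval 0 ≠ 0) {c : ℕ}
    (hc : 2 * c + 1 = Fintype.card K) {D : ℕ} (hD : 2 * D + f.natDegree ≤ Fintype.card K)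
    {r s : K[X]} (hr : r.natDegree < D) (hs : s.natDegree < D)
    (h : X ^ Fintype.card K ∣ r + s * f ^ c) : r = 0 ∧ s = 0 := by
  have hf : f ≠ 0 := by rintro rfl; simp at hf0
  have h1 : X ^ Fintype.card K ∣ r ^ 2 * f - C (f.eval 0) * s ^ 2 := by
    have h2 : X ^ Fintype.card K ∣ f ^ Fintype.card K - C (f.eval 0) := by
      have h3 : (X : K[X]) ∣ f - C (f.eval 0) := by
        rw [X_dvd_iff, coeff_sub, coeff_C_zero, coeff_zero_eq_eval_zero, sub_self]
      have h4 := pow_dvd_pow_of_dvd h3 (Fintype.card K)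
      rw [← FiniteField.expand_card (f - _), map_sub, expand_C, FiniteField.expand_card] at h4
      exact h4
    have e : r ^ 2 * f - C (f.eval 0) * s ^ 2
        = (r + s * f ^ c) * ((r - s * f ^ c) * f)
          + (f ^ Fintype.card K - C (f.eval 0)) * s ^ 2 := by
      rw [← hc]; ring
    rw [e]
    exact dvd_add (h.mul_right _) (h2.mul_right _)
  have h2 : r ^ 2 * f = C (f.eval 0) * s ^ 2 := by
    rw [← sub_eq_zero]
    refine eq_zero_of_dvd_of_natDegree_lt h1 ?_
    rw [natDegree_X_pow]
    refine lt_of_le_of_lt (natDegree_sub_le _ _) (max_lt ?_ ?_)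
    · refine lt_of_le_of_lt natDegree_mul_le ?_
      have := natDegree_pow_le (p := r) (n := 2)
      omega
    · refine lt_of_le_of_lt (natDegree_C_mul_le _ _) ?_
      have := natDegree_pow_le (p := s) (n := 2)
      omega
  have hs0 := eq_zero_of_sq_mul_eq hp hpf hpf2 hf0 h2
  refine ⟨?_, hs0⟩
  rw [hs0] at h2
  simpa [hf] using h2

theorem sum_X_pow_card_mul_ne_zero {K : Type*} [Field K] [Fintype K] {J : ℕ}
    {u : Fin J → K[X]} (hu : ∀ j, X ^ Fintype.card K ∣ u j → u j = 0) (hne : ∃ j, u j ≠ 0) :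
    ∑ j : Fin J, X ^ ((j : ℕ) * Fintype.card K) * u j ≠ 0 := by
  intro h
  -- Modulo `X ^ ((j + 1) q)`, only the first nonzero `u j` survives.
  obtain ⟨j, hj, hmin⟩ := WellFounded.has_min (r := ((· < ·) : Fin J → Fin J → Prop))
    wellFounded_lt {j | u j ≠ 0} hne
  refine hj (hu j ?_)
  rw [← Finset.add_sum_erase _ _ (Finset.mem_univ j)] at h
  have h1 : X ^ ((j : ℕ) * Fintype.card K) * X ^ Fintype.card K
      ∣ X ^ ((j : ℕ) * Fintype.card K) * u j := by
    rw [eq_neg_of_add_eq_zero_left h, dvd_neg, ← pow_add]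
    refine Finset.dvd_sum fun i hi => ?_
    rw [Finset.mem_erase] at hi
    by_cases h0 : u i = 0
    · simp [h0]
    have hij : j < i := lt_of_le_of_ne (not_lt.1 fun hlt => hmin i h0 hlt) hi.1.symm
    refine (pow_dvd_pow _ ?_).mul_right _
    calc (j : ℕ) * Fintype.card K + Fintype.card K = ((j : ℕ) + 1) * Fintype.card K := by ring
      _ ≤ _ := Nat.mul_le_mul_right _ hij
  exact (mul_dvd_mul_iff_left (pow_ne_zero _ X_ne_zero)).1 h1

/-- Stepanov's method: the number of `x` at which `f ^ ((q - 1) / 2)` takes the value `a`, in terms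
of the parameters `l` (the order of vanishing), `D` and `J` (the degrees of freedom) of the
auxiliary polynomial. -/
theorem stepanov_card_mul_le {K : Type*} [Field K] [Fintype K] {f p : K[X]} (hp : Prime p)
    (hpf : p ∣ f) (hpf2 : ¬ p ^ 2 ∣ f) (hf0 : f.eval 0 ≠ 0) {c : ℕ}
    (hc : 2 * c + 1 = Fintype.card K) {D J l : ℕ} (hD1 : 1 ≤ D)
    (hD : 2 * D + f.natDegree ≤ Fintype.card K) (hl : l ≤ Fintype.card K)
    (hcount : l * (D + l * f.natDegree + J) < 2 * J * D)
    (a : K) (Z : Finset K) (hZ : ∀ x ∈ Z, f.eval x ^ c = a) :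
    Z.card * l ≤ l * f.natDegree + c * f.natDegree + D + J * Fintype.card K := by
  classical
  set m := f.natDegree with hm
  set q := Fintype.card K with hq
  have hf : f ≠ 0 := by rintro rfl; simp at hf0
  choose L₁ hL₁ using fun k : Fin l => exists_hasseDeriv_pow_mul hf (N := l) k.2.le
  choose L₂ hL₂ using fun k : Fin l =>
    exists_hasseDeriv_pow_mul hf (N := l + c) (k.2.le.trans (Nat.le_add_right l c))
  set M := D + l * m + J with hM
  -- The conditions that make the auxiliary polynomial vanish to order `l` at the points of `Z`.
  let Q (k : Fin l) : (Fin J → (Fin D → K) × (Fin D → K)) →ₗ[K] K[X] :=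
    ∑ j : Fin J, (LinearMap.mulLeft K (X ^ (j : ℕ))).comp
      (((L₁ k).comp ((ofFn D).comp ((LinearMap.fst K _ _).comp (LinearMap.proj j))))
        + a • ((L₂ k).comp ((ofFn D).comp ((LinearMap.snd K _ _).comp (LinearMap.proj j)))))
  have hQ : ∀ k v, Q k v = ∑ j : Fin J,
      X ^ (j : ℕ) * (L₁ k (ofFn D (v j).1) + a • L₂ k (ofFn D (v j).2)) := by
    intro k v
    simp only [Q, LinearMap.sum_apply, LinearMap.comp_apply, LinearMap.mulLeft_apply,
      LinearMap.add_apply, LinearMap.smul_apply, LinearMap.fst_apply, LinearMap.snd_apply,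
      LinearMap.proj_apply]
  have hQdeg : ∀ k v, (Q k v).natDegree < M := by
    intro k v
    have hJ : 0 < J := by
      rcases Nat.eq_zero_or_pos J with h | h
      · simp [h] at hcount
      · exact h
    rw [hQ]
    have hkm : (k : ℕ) * m ≤ l * m := Nat.mul_le_mul_right _ k.2.le
    have : (∑ j : Fin J, X ^ (j : ℕ) *
        (L₁ k (ofFn D (v j).1) + a • L₂ k (ofFn D (v j).2))).natDegree
          ≤ (J - 1) + ((D - 1) + l * m) := by
      refine natDegree_sum_le_of_forall_le _ _ fun j _ => ?_
      refine natDegree_mul_le_of_le ((natDegree_X_pow_le _).trans (by omega)) ?_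
      refine (natDegree_add_le _ _).trans (max_le ?_ ((natDegree_smul_le _ _).trans ?_))
      · have h1 := (hL₁ k (ofFn D (v j).1)).2
        have h2 := ofFn_natDegree_lt hD1 (v j).1
        rw [← hm] at h1
        omega
      · have h1 := (hL₂ k (ofFn D (v j).2)).2
        have h2 := ofFn_natDegree_lt hD1 (v j).2
        rw [← hm] at h1
        omega
    omega
  let Φ : (Fin J → (Fin D → K) × (Fin D → K)) →ₗ[K] (Fin l → Fin M → K) :=
    LinearMap.pi fun k => (toFn M).comp (Q k)
  have hker : LinearMap.ker Φ ≠ ⊥ := by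
    apply LinearMap.ker_ne_bot_of_finrank_lt
    simp only [Module.finrank_pi_fintype, Module.finrank_prod, Module.finrank_self,
      Finset.sum_const, Finset.card_univ, Fintype.card_fin, smul_eq_mul, mul_one]
    calc l * M < 2 * J * D := hcount
      _ = J * (D + D) := by ring
  obtain ⟨v, hvker, hv⟩ := Submodule.exists_mem_ne_zero_of_ne_bot hker
  have hQ0 : ∀ k, Q k v = 0 := by
    intro k
    ext i
    rw [coeff_zero]
    by_cases hi : i < M
    · have h := congrFun (congrFun (LinearMap.mem_ker.1 hvker) k) ⟨i, hi⟩
      simpa [Φ, toFn] using h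
    · exact coeff_eq_zero_of_natDegree_lt ((hQdeg k v).trans_le (not_lt.1 hi))
  set r : Fin J → K[X] := fun j => ofFn D (v j).1 with hr
  set s : Fin J → K[X] := fun j => ofFn D (v j).2 with hs
  have hrdeg : ∀ j, (r j).natDegree < D := fun j => ofFn_natDegree_lt hD1 _
  have hsdeg : ∀ j, (s j).natDegree < D := fun j => ofFn_natDegree_lt hD1 _
  set P : K[X] := ∑ j : Fin J, X ^ ((j : ℕ) * q) * (f ^ l * r j + f ^ (l + c) * s j) with hP
  have hP0 : P ≠ 0 := by
    have e : P = f ^ l * ∑ j : Fin J, X ^ ((j : ℕ) * q) * (r j + s j * f ^ c) := by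
      rw [hP, Finset.mul_sum]
      exact Finset.sum_congr rfl fun j _ => by rw [pow_add]; ring
    rw [e]
    refine mul_ne_zero (pow_ne_zero _ hf) (sum_X_pow_card_mul_ne_zero (fun j hj => ?_) ?_)
    · obtain ⟨h1, h2⟩ :=
        eq_zero_of_X_pow_card_dvd hp hpf hpf2 hf0 hc hD (hrdeg j) (hsdeg j) hj
      rw [h1, h2]; simp
    · by_contra! hall
      apply hv
      funext j
      obtain ⟨h1, h2⟩ := eq_zero_of_X_pow_card_dvd hp hpf hpf2 hf0 hc hD (hrdeg j) (hsdeg j)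
        (by rw [hall j]; exact dvd_zero _)
      refine Prod.ext ?_ ?_
      · have := toFn_comp_ofFn_eq_id D (v j).1
        rw [← this]
        change toFn D (r j) = 0
        rw [h1, map_zero]
      · have := toFn_comp_ofFn_eq_id D (v j).2
        rw [← this]
        change toFn D (s j) = 0
        rw [h2, map_zero]
  have hPdeg : P.natDegree ≤ l * m + c * m + D + J * q := by
    refine natDegree_sum_le_of_forall_le _ _ fun j _ => ?_
    have hjq : (j : ℕ) * q ≤ J * q := Nat.mul_le_mul_right _ j.2.le
    have h : (X ^ ((j : ℕ) * q) * (f ^ l * r j + f ^ (l + c) * s j)).natDegree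
        ≤ J * q + ((l + c) * m + D) := by
      refine natDegree_mul_le_of_le ((natDegree_X_pow_le _).trans hjq) ?_
      refine (natDegree_add_le _ _).trans (max_le ?_ ?_)
      · refine natDegree_mul_le_of_le (natDegree_pow_le.trans ?_) (hrdeg j).le
        exact Nat.mul_le_mul_right _ (Nat.le_add_right l c)
      · exact natDegree_mul_le_of_le natDegree_pow_le (hsdeg j).le
    have e : (l + c) * m = l * m + c * m := add_mul _ _ _
    omega
  refine (card_mul_le_natDegree_of_hasseDeriv_eval hP0 Z fun x hx k hk => ?_).trans hPdeg
  -- On `Z`, `x ^ q = x` and `f ^ c = a`, so the `k`-th derivative of `P` is a multiple of `Q k v`.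
  have hfix : ∀ j : ℕ, x ^ (j * q) = x ^ j := fun j => by
    rw [mul_comm, pow_mul, hq, FiniteField.pow_card]
  have hQx := congrArg (eval x) (hQ0 ⟨k, hk⟩)
  rw [hQ, eval_zero, eval_finsetSum] at hQx
  have e : (hasseDeriv k P).eval x = f.eval x ^ (l - k) * ∑ j : Fin J,
      (X ^ (j : ℕ) * (L₁ ⟨k, hk⟩ (r j) + a • L₂ ⟨k, hk⟩ (s j))).eval x := by
    rw [hP, map_sum, eval_finsetSum, Finset.mul_sum]
    refine Finset.sum_congr rfl fun j _ => ?_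
    have hlc : l + c - k = (l - k) + c := by omega
    rw [hasseDeriv_X_pow_card_mul _ (hk.trans_le hl), map_add, (hL₁ ⟨k, hk⟩ (r j)).1,
      (hL₂ ⟨k, hk⟩ (s j)).1]
    simp only [eval_mul, eval_add, eval_pow, eval_X, eval_smul, smul_eq_mul, hlc, pow_add]
    rw [← hq, hfix, hZ x hx]
    ring
  rw [e, hQx, mul_zero]

/-- Stepanov's bound with the parameters chosen: `l = ⌊√q⌋`. -/
theorem stepanov_two_mul_card_le {K : Type*} [Field K] [Fintype K] {f p : K[X]} (hp : Prime p)
    (hpf : p ∣ f) (hpf2 : ¬ p ^ 2 ∣ f) (hf0 : f.eval 0 ≠ 0) {c M : ℕ}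
    (hc : 2 * c + 1 = Fintype.card K) (hM : f.natDegree ≤ M)
    (hlarge : 4 * (M + 2) ≤ Nat.sqrt (Fintype.card K))
    (a : K) (Z : Finset K) (hZ : ∀ x ∈ Z, f.eval x ^ c = a) :
    2 * Z.card ≤ Fintype.card K + Nat.sqrt (Fintype.card K) * (11 * M + 15) := by
  set q := Fintype.card K with hq
  set l := Nat.sqrt q with hl
  have hl2 : l * l ≤ q := Nat.sqrt_le q
  have hq2 : q ≤ l * l + l + l := Nat.sqrt_le_add q
  have hlq : l ≤ q := Nat.sqrt_le_self q
  have hlM : 4 * (M + 2) * l ≤ l * l := Nat.mul_le_mul_right l hlarge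
  have hMM : 4 * (M + 2) * (M + 2) ≤ l * (M + 2) := Nat.mul_le_mul_right _ hlarge
  -- `2 * D ≈ q - M` is the most that nonvanishing allows; `2 * J ≈ l` to first order, with a
  -- bounded excess so that the unknowns outnumber the equations.
  obtain ⟨D, hDle, hDge⟩ : ∃ D, 2 * D + M ≤ q ∧ q ≤ 2 * D + M + 1 := by
    refine ⟨(q - M) / 2, ?_, ?_⟩ <;> omega
  have hD1 : 1 ≤ D := by nlinarith
  obtain ⟨J, hJle, hJge⟩ : ∃ J, 2 * J ≤ l + 2 * (M + 2) ∧ l + 2 * (M + 2) ≤ 2 * J + 1 :=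
    ⟨(l + 2 * (M + 2)) / 2, by omega, by omega⟩
  have hcount : l * (D + l * f.natDegree + J) < 2 * J * D := by
    have h1 : l * (D + l * f.natDegree + J) ≤ l * (D + l * M + J) := by gcongr
    refine h1.trans_lt ?_
    have h2 : (l + 2 * (M + 2)) * D ≤ (2 * J + 1) * D := Nat.mul_le_mul_right _ hJge
    have h3 : l * (2 * J) ≤ l * (l + 2 * (M + 2)) := Nat.mul_le_mul_left _ hJle
    have h4 : l * l * (2 * M + 1) ≤ q * (2 * M + 1) := Nat.mul_le_mul_right _ hl2
    have h5 : q * (2 * M + 3) ≤ (2 * D + M + 1) * (2 * M + 3) := Nat.mul_le_mul_right _ hDge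
    nlinarith
  have h := stepanov_card_mul_le hp hpf hpf2 hf0 hc hD1 (by omega) hlq hcount a Z hZ
  have hl1 : 0 < l := by omega
  refine le_of_mul_le_mul_left (a := l) ?_ hl1
  have e1 : l * f.natDegree ≤ l * M := Nat.mul_le_mul_left _ hM
  have e2 : c * f.natDegree ≤ c * M := Nat.mul_le_mul_left _ hM
  have e3 : 2 * J * q ≤ (l + 2 * (M + 2)) * q := Nat.mul_le_mul_right _ hJle
  have e4 : (2 * c + 1) * M = q * M := by rw [hc]
  have e5 : q * (3 * M + 5) ≤ (3 * (l * l)) * (3 * M + 5) := by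
    refine Nat.mul_le_mul_right _ ?_
    nlinarith
  have e6 : l * M ≤ l * l * M := by
    have : l * 1 ≤ l * l := Nat.mul_le_mul_left _ hl1
    exact Nat.mul_le_mul_right _ (by omega)
  nlinarith

/-- The Weil bound for quadratic character sums of polynomials of bounded degree, with an
unspecified constant. The polynomial is required to have a prime factor of multiplicity one, and
not to vanish at `0`. -/
theorem sq_sum_quadraticChar_eval_le {K : Type*} [Field K] [Fintype K] [DecidableEq K]
    (hK : Odd (Fintype.card K)) {f p : K[X]} (hp : Prime p) (hpf : p ∣ f) (hpf2 : ¬ p ^ 2 ∣ f)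
    (hf0 : f.eval 0 ≠ 0) {M : ℕ} (hM : f.natDegree ≤ M) :
    (∑ x, quadraticChar K (f.eval x)) ^ 2 ≤ (12 * M + 15) ^ 2 * (Fintype.card K : ℤ) := by
  obtain ⟨c, hc⟩ := hK
  have hchar : ringChar K ≠ 2 := by
    intro h
    have := FiniteField.even_card_of_char_two h
    omega
  have hf : f ≠ 0 := by rintro rfl; simp at hf0
  set q := Fintype.card K with hq
  set Z : ℤ → Finset K := fun ε => {x | quadraticChar K (f.eval x) = ε} with hZ
  have hval : ∀ y : K, quadraticChar K y = 0 ∨ quadraticChar K y = 1 ∨ quadraticChar K y = -1 :=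
    fun y => quadraticChar_isQuadratic K y
  have hsum : ∑ x, quadraticChar K (f.eval x) = (Z 1).card - (Z (-1)).card := by
    simp only [hZ, Finset.card_filter, Nat.cast_sum, ← Finset.sum_sub_distrib]
    refine Finset.sum_congr rfl fun x _ => ?_
    rcases hval (f.eval x) with h | h | h <;> simp [h]
  have hcard : (q : ℤ) = (Z 1).card + (Z (-1)).card + (Z 0).card := by
    simp only [hZ, Finset.card_filter, Nat.cast_sum, ← Finset.sum_add_distrib]
    rw [hq, ← Finset.card_univ, Finset.card_eq_sum_ones, Nat.cast_sum]
    refine Finset.sum_congr rfl fun x _ => ?_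
    rcases hval (f.eval x) with h | h | h <;> simp [h]
  have hzero : (Z 0).card ≤ M := by
    refine le_trans ?_ hM
    refine le_trans (Finset.card_le_card (t := f.roots.toFinset) fun x hx => ?_)
      ((Multiset.toFinset_card_le _).trans (card_roots' f))
    simp only [hZ, Finset.mem_filter, Finset.mem_univ, true_and, quadraticChar_eq_zero_iff] at hx
    simpa [hf] using hx
  set l := Nat.sqrt q with hl
  have hl2 : l * l ≤ q := Nat.sqrt_le q
  have hq2 : q ≤ l * l + l + l := Nat.sqrt_le_add q
  suffices h : |(∑ x, quadraticChar K (f.eval x))| ≤ (12 * M + 15 : ℤ) * l by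
    calc (∑ x, quadraticChar K (f.eval x)) ^ 2 ≤ ((12 * M + 15 : ℤ) * l) ^ 2 :=
          sq_le_sq' (abs_le.1 h).1 (abs_le.1 h).2
      _ = (12 * M + 15) ^ 2 * ((l * l : ℕ) : ℤ) := by push_cast; ring
      _ ≤ _ := by gcongr
  have hl1 : 1 ≤ l := by
    rw [hl, Nat.le_sqrt']
    omega
  by_cases hlarge : 4 * (M + 2) ≤ l
  · have key : ∀ ε : ℤ, 2 * (Z ε).card ≤ q + l * (11 * M + 15) := fun ε => by
      refine stepanov_two_mul_card_le hp hpf hpf2 hf0 hc.symm hM hlarge (ε : K) _ fun x hx => ?_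
      simp only [hZ, Finset.mem_filter, Finset.mem_univ, true_and] at hx
      rw [← hx, quadraticChar_eq_pow_of_char_ne_two' hchar]
      congr 1
      omega
    have h1 := key 1
    have h2 := key (-1)
    have h3 : M ≤ l * M := Nat.le_mul_of_pos_left _ hl1
    rw [hsum, abs_le]
    zify at h1 h2 h3 hzero
    constructor <;> nlinarith
  · have h1 : (q : ℤ) ≤ (12 * M + 15) * l := by
      have : q ≤ l * (l + 2) := by nlinarith
      have h2 : l * (l + 2) ≤ l * (12 * M + 15) := Nat.mul_le_mul_left _ (by omega)
      have h3 := this.trans h2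
      zify at h3
      linarith
    rw [hsum, abs_le]
    constructor <;> omega

end Stepanov

/-! ### Elementary averages over `ι → F` -/

theorem card_mul_sum_eq_sum_sum_update {ι F : Type*} [Fintype ι] [DecidableEq ι] [Fintype F]
    (v : ι) (Φ : (ι → F) → ℤ) :
    (Fintype.card F : ℤ) * ∑ a, Φ a = ∑ a, ∑ x, Φ (Function.update a v x) := by
  let σ : (ι → F) × F → (ι → F) × F := fun p => (Function.update p.1 v p.2, p.1 v)
  have hσ : Function.Involutive σ := fun p => by simp [σ]
  calc (Fintype.card F : ℤ) * ∑ a, Φ a = ∑ p : (ι → F) × F, Φ p.1 := by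
        rw [Fintype.sum_prod_type, Finset.mul_sum]
        simp
    _ = ∑ p : (ι → F) × F, Φ (σ p).1 := (Equiv.sum_comp hσ.toPerm fun p => Φ p.1).symm
    _ = _ := by rw [Fintype.sum_prod_type]

/-- A hypersurface that is a graph over a coordinate hyperplane has `q ^ (m - 1)` points. -/
theorem card_mul_card_filter_eq {ι F : Type*} [Fintype ι] [DecidableEq ι] [Fintype F]
    [DecidableEq F] (v : ι) (g : (ι → F) → F) (hg : ∀ a x, g (Function.update a v x) = g a) :
    Fintype.card F * (Finset.univ.filter fun a : ι → F => a v = g a).card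
      = Fintype.card F ^ Fintype.card ι := by
  have h := card_mul_sum_eq_sum_sum_update v fun a : ι → F => if a v = g a then (1 : ℤ) else 0
  simp only [Function.update_self, hg, Finset.sum_ite_eq', Finset.mem_univ, if_true,
    Finset.sum_boole, Finset.sum_const, Finset.card_univ, Fintype.card_pi, Finset.prod_const,
    nsmul_eq_mul, mul_one] at h
  exact_mod_cast h

section CharSums

open Polynomial

variable {F : Type*} [Field F] [Fintype F] [DecidableEq F]

theorem abs_quadraticChar_le_one (x : F) : |quadraticChar F x| ≤ 1 := by
  rcases quadraticChar_isQuadratic F x with h | h | h <;> simp [h]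

theorem sum_quadraticChar_mul_add (hF : ringChar F ≠ 2) {x : F} (hx : x ≠ 0) (r : F) :
    ∑ y, quadraticChar F (x * y + r) = 0 := by
  let e : F ≃ F := (Equiv.mulLeft₀ x hx).trans (Equiv.addRight r)
  exact (Equiv.sum_comp e fun y => quadraticChar F y).trans (quadraticChar_sum_zero hF)

/-- The correlation of two distinct rows of the matrix `χ(x y + r)` is `O(1)`: an affine
substitution turns it into a Jacobi sum. -/
theorem abs_sum_quadraticChar_mul_quadraticChar_le (hF : ringChar F ≠ 2) {r : F} (hr : r ≠ 0)
    {x x' : F} (hxx : x ≠ x') :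
    |∑ y, quadraticChar F (x * y + r) * quadraticChar F (x' * y + r)| ≤ 1 := by
  by_cases hx : x = 0
  · subst hx
    simp_rw [zero_mul, zero_add]
    rw [← Finset.mul_sum, sum_quadraticChar_mul_add hF hxx.symm]
    simp
  by_cases hx' : x' = 0
  · subst hx'
    simp_rw [zero_mul, zero_add]
    rw [← Finset.sum_mul, sum_quadraticChar_mul_add hF hx]
    simp
  have hd : x' - x ≠ 0 := sub_ne_zero.2 hxx.symm
  -- With these multipliers, `α (x y + r) + β (x' y + r) = 1`.
  set α : F := x' / (r * (x' - x)) with hα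
  set β : F := -x / (r * (x' - x)) with hβ
  have hα0 : α ≠ 0 := div_ne_zero hx' (mul_ne_zero hr hd)
  have hβ0 : β ≠ 0 := div_ne_zero (neg_ne_zero.2 hx) (mul_ne_zero hr hd)
  let e : F ≃ F := (Equiv.mulLeft₀ (α * x) (mul_ne_zero hα0 hx)).trans (Equiv.addRight (α * r))
  have h1 : quadraticChar F α * quadraticChar F β *
      ∑ y, quadraticChar F (x * y + r) * quadraticChar F (x' * y + r)
      = jacobiSum (quadraticChar F) (quadraticChar F) := by
    rw [jacobiSum, Finset.mul_sum]
    refine Eq.trans ?_ (Equiv.sum_comp e fun z => quadraticChar F z * quadraticChar F (1 - z))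
    refine Finset.sum_congr rfl fun y _ => ?_
    have e1 : e y = α * (x * y + r) := by
      change α * x * y + α * r = _
      ring
    have e2 : 1 - e y = β * (x' * y + r) := by
      rw [e1, hα, hβ]
      field_simp
      ring
    rw [e1] at e2 ⊢
    rw [e2, map_mul, map_mul]
    ring
  have h2 : jacobiSum (quadraticChar F) (quadraticChar F) = -quadraticChar F (-1) := by
    have := jacobiSum_nontrivial_inv (quadraticChar_ne_one hF)
    rwa [(quadraticChar_isQuadratic F).inv] at this
  have h3 : ∀ z : F, z ≠ 0 → |quadraticChar F z| = 1 := fun z hz => by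
    rcases quadraticChar_dichotomy hz with h | h <;> simp [h]
  have h4 := congrArg abs h1
  rw [abs_mul, abs_mul, h3 α hα0, h3 β hβ0, h2, abs_neg, h3 (-1) (by simp)] at h4
  linarith

/-! ### Character sums attached to graphs -/

variable {ι : Type*}

/-- The product of `χ(a i * a j + r)` over the edges `(i, j)` of `E`, with `χ` the quadratic
character. A graph is encoded as a set of ordered pairs; where it matters that it is simple,
`e.1 < e.2` is assumed for its edges `e`. -/
def edgeProd (r : F) (E : Finset (ι × ι)) (a : ι → F) : ℤ :=
  ∏ e ∈ E, quadraticChar F (a e.1 * a e.2 + r)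

theorem abs_edgeProd_le_one (r : F) (E : Finset (ι × ι)) (a : ι → F) :
    |edgeProd r E a| ≤ 1 := by
  rw [edgeProd, Finset.abs_prod]
  exact Finset.prod_le_one (fun _ _ => abs_nonneg _) fun _ _ => abs_quadraticChar_le_one _

theorem edgeProd_congr (r : F) {E : Finset (ι × ι)} {a b : ι → F}
    (h : ∀ e ∈ E, a e.1 * a e.2 = b e.1 * b e.2) : edgeProd r E a = edgeProd r E b :=
  Finset.prod_congr rfl fun e he => by rw [h e he]

theorem edgeProd_update_of_notMem [DecidableEq ι] (r : F) {E : Finset (ι × ι)} {w : ι}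
    (h : ∀ e ∈ E, e.1 ≠ w ∧ e.2 ≠ w) (a : ι → F) (y : F) :
    edgeProd r E (Function.update a w y) = edgeProd r E a :=
  edgeProd_congr r fun e he => by
    rw [Function.update_of_ne (h e he).1, Function.update_of_ne (h e he).2]

/-- The mean square of the sum over one vertex `v` of positive degree is `O(q)`. Averaging over a
single neighbour of `v` is enough. -/
theorem card_mul_sum_sq_sum_edgeProd_le [Fintype ι] [LinearOrder ι] (hF : ringChar F ≠ 2)
    {r : F} (hr : r ≠ 0) {E : Finset (ι × ι)} (hE : ∀ e ∈ E, e.1 < e.2) {v : ι}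
    (hv : ∀ e ∈ E, e.1 = v ∨ e.2 = v)
    (hne : E.Nonempty) :
    (Fintype.card F : ℤ) * ∑ a, (∑ x, edgeProd r E (Function.update a v x)) ^ 2
      ≤ 2 * (Fintype.card F : ℤ) ^ 2 * (Fintype.card F : ℤ) ^ Fintype.card ι := by
  set q : ℤ := (Fintype.card F : ℤ) with hq
  have hcardι : ((Fintype.card (ι → F) : ℕ) : ℤ) = q ^ Fintype.card ι := by
    simp [hq]
  obtain ⟨e₀, he₀⟩ := hne
  -- `w` is the other end of `e₀`; no other edge contains it, as all of them contain `v`.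
  obtain ⟨w, hwv, hw₀, hw⟩ : ∃ w, w ≠ v ∧
      (∀ a : ι → F, a e₀.1 * a e₀.2 = a v * a w) ∧ ∀ e ∈ E.erase e₀, e.1 ≠ w ∧ e.2 ≠ w := by
    have h0 := hE e₀ he₀
    rcases hv e₀ he₀ with h | h
    · refine ⟨e₀.2, by rw [← h]; exact h0.ne', fun a => by rw [h], fun e he => ?_⟩
      have he' := Finset.mem_erase.1 he
      have h1 := hE e he'.2
      have h2 := hv e he'.2
      have h3 : ¬ (e.1 = e₀.1 ∧ e.2 = e₀.2) := fun h => he'.1 (Prod.ext h.1 h.2)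
      constructor <;> intro h4 <;> grind
    · refine ⟨e₀.1, by rw [← h]; exact h0.ne, fun a => by rw [h, mul_comm], fun e he => ?_⟩
      have he' := Finset.mem_erase.1 he
      have h1 := hE e he'.2
      have h2 := hv e he'.2
      have h3 : ¬ (e.1 = e₀.1 ∧ e.2 = e₀.2) := fun h => he'.1 (Prod.ext h.1 h.2)
      constructor <;> intro h4 <;> grind
  have hsplit : ∀ (a : ι → F) (x y : F),
      edgeProd r E (Function.update (Function.update a w y) v x)
        = quadraticChar F (x * y + r) * edgeProd r (E.erase e₀) (Function.update a v x) := by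
    intro a x y
    rw [edgeProd, ← Finset.mul_prod_erase _ _ he₀, hw₀, Function.update_self,
      Function.update_of_ne hwv, Function.update_self, Function.update_comm hwv]
    congr 1
    exact edgeProd_update_of_notMem r hw _ _
  have hcor : ∀ x x' : F, q * ∑ a, edgeProd r E (Function.update a v x) *
      edgeProd r E (Function.update a v x') ≤ (if x = x' then q else 1) * q ^ Fintype.card ι := by
    intro x x'
    rw [card_mul_sum_eq_sum_sum_update w]
    rw [← hcardι, mul_comm, ← Finset.card_univ, ← nsmul_eq_mul]
    refine Finset.sum_le_card_nsmul _ _ _ fun a _ => ?_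
    split_ifs with h
    · rw [hq, ← Finset.card_univ, ← mul_one ((Finset.card _ : ℕ) : ℤ), ← nsmul_eq_mul]
      refine Finset.sum_le_card_nsmul _ _ _ fun y _ => ?_
      refine (le_abs_self _).trans ?_
      rw [abs_mul]
      exact mul_le_one₀ (abs_edgeProd_le_one _ _ _) (abs_nonneg _) (abs_edgeProd_le_one _ _ _)
    · have e : ∑ y, edgeProd r E (Function.update (Function.update a w y) v x) *
          edgeProd r E (Function.update (Function.update a w y) v x')
          = (∑ y, quadraticChar F (x * y + r) * quadraticChar F (x' * y + r)) *
            (edgeProd r (E.erase e₀) (Function.update a v x) *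
              edgeProd r (E.erase e₀) (Function.update a v x')) := by
        rw [Finset.sum_mul]
        exact Finset.sum_congr rfl fun y _ => by rw [hsplit, hsplit]; ring
      rw [e]
      refine (le_abs_self _).trans ?_
      rw [abs_mul, abs_mul]
      exact mul_le_one₀ (abs_sum_quadraticChar_mul_quadraticChar_le hF hr h) (by positivity)
        (mul_le_one₀ (abs_edgeProd_le_one _ _ _) (abs_nonneg _) (abs_edgeProd_le_one _ _ _))
  calc q * ∑ a, (∑ x, edgeProd r E (Function.update a v x)) ^ 2
      = ∑ x, ∑ x', q * ∑ a, edgeProd r E (Function.update a v x) *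
          edgeProd r E (Function.update a v x') := by
        simp_rw [sq, Finset.sum_mul_sum]
        rw [Finset.sum_comm, Finset.mul_sum]
        refine Finset.sum_congr rfl fun x _ => ?_
        rw [Finset.sum_comm, Finset.mul_sum]
    _ ≤ ∑ x : F, ∑ x' : F, (if x = x' then q else 1) * q ^ Fintype.card ι :=
        Finset.sum_le_sum fun x _ => Finset.sum_le_sum fun x' _ => hcor x x'
    _ ≤ ∑ x : F, ∑ x' : F, ((if x = x' then q else 0) + 1) * q ^ Fintype.card ι := by
        gcongr with x _ x' _
        split_ifs <;> omega
    _ = _ := by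
        simp_rw [← Finset.sum_mul, Finset.sum_add_distrib]
        simp only [Finset.sum_ite_eq, Finset.mem_univ, if_true, Finset.sum_const,
          Finset.card_univ, nsmul_eq_mul, ← hq]
        ring

/-- Away from a set of tuples of codimension one, the polynomial `∏ (a i * a j * X ^ 2 + r)` has
the simple factor `a i₀ * a j₀ * X ^ 2 + r`, so that Weil's bound applies. -/
theorem sq_sum_edgeProd_smul_le [DecidableEq ι] (hF : ringChar F ≠ 2) {r : F} (hr : r ≠ 0)
    {E : Finset (ι × ι)} {e₀ : ι × ι} (he₀ : e₀ ∈ E) {a : ι → F} (h0 : a e₀.1 * a e₀.2 ≠ 0)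
    (hne : ∀ e ∈ E, e ≠ e₀ → a e.1 * a e.2 ≠ a e₀.1 * a e₀.2) :
    (∑ t : F, edgeProd r E (fun i => t * a i)) ^ 2
      ≤ (24 * E.card + 15) ^ 2 * (Fintype.card F : ℤ) := by
  set g : ι × ι → F[X] := fun e => C (a e.1 * a e.2) * X ^ 2 + C r with hg
  have hgdeg : ∀ e, (g e).natDegree ≤ 2 := fun e => by
    exact natDegree_add_le_of_degree_le (natDegree_C_mul_X_pow_le _ _) (by simp)
  have hg0 : (g e₀).natDegree = 2 := by
    simp only [hg]
    rw [natDegree_add_C, natDegree_C_mul_X_pow 2 _ h0]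
  have hunit : ∀ {c : F}, c ≠ 0 → ∀ {p : F[X]}, Prime p → ¬ p ∣ C c := fun hc p hp hd =>
    hp.not_isUnit (isUnit_of_dvd_unit hd (isUnit_C.2 (isUnit_iff_ne_zero.2 hc)))
  obtain ⟨p, hpirr, hpg⟩ := exists_irreducible_of_natDegree_pos (f := g e₀) (by omega)
  have hp : Prime p := hpirr.prime
  have hsq : ¬ p ^ 2 ∣ g e₀ := by
    rintro ⟨k, hk⟩
    have h1 : p ∣ derivative (g e₀) := by
      rw [hk, derivative_mul, derivative_sq]
      exact dvd_add (((dvd_mul_left p _).mul_right _).mul_right _)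
        ((dvd_pow_self p two_ne_zero).mul_right _)
    -- Euler's relation: `2 g - X g'` is the constant `2 r`.
    have h2 : C (2 * r) = 2 * g e₀ - X * derivative (g e₀) := by
      simp only [hg, derivative_add, derivative_mul, derivative_C, derivative_X_pow, C_mul]
      simp only [map_ofNat, Nat.cast_ofNat]
      ring
    refine hunit (mul_ne_zero (Ring.two_ne_zero hF) hr) hp ?_
    rw [h2]
    exact dvd_sub (hpg.mul_left _) (h1.mul_left _)
  have hother : ∀ e ∈ E.erase e₀, ¬ p ∣ g e := by
    intro e he hpe
    rw [Finset.mem_erase] at he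
    have h1 : C (r * (a e₀.1 * a e₀.2 - a e.1 * a e.2))
        = C (a e₀.1 * a e₀.2) * g e - C (a e.1 * a e.2) * g e₀ := by
      simp only [hg, C_mul, C_sub]
      ring
    refine hunit (mul_ne_zero hr (sub_ne_zero.2 (hne e he.2 he.1).symm)) hp ?_
    rw [h1]
    exact dvd_sub (hpe.mul_left _) (hpg.mul_left _)
  set f : F[X] := ∏ e ∈ E, g e with hf
  have hfe : f = g e₀ * ∏ e ∈ E.erase e₀, g e := (Finset.mul_prod_erase _ _ he₀).symm
  have hpf : p ∣ f := hfe ▸ hpg.mul_right _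
  have hpf2 : ¬ p ^ 2 ∣ f := by
    intro h
    rw [hfe] at h
    refine hsq (hp.pow_dvd_of_dvd_mul_right 2 ?_ h)
    rw [hp.dvd_finsetProd_iff]
    rintro ⟨e, he, hd⟩
    exact hother e he hd
  have hf0 : f.eval 0 ≠ 0 := by
    rw [hf, eval_prod, Finset.prod_ne_zero_iff]
    intro e _
    simpa [hg] using hr
  have hdeg : f.natDegree ≤ 2 * E.card := by
    refine (natDegree_prod_le _ _).trans
      ((Finset.sum_le_card_nsmul _ _ 2 fun e _ => hgdeg e).trans ?_)
    rw [smul_eq_mul, mul_comm]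
  have hodd : Odd (Fintype.card F) := Nat.odd_iff.2 (FiniteField.odd_card_of_char_ne_two hF)
  have h := sq_sum_quadraticChar_eval_le hodd hp hpf hpf2 hf0 hdeg
  have e : ∀ t : F, edgeProd r E (fun i => t * a i) = quadraticChar F (f.eval t) := by
    intro t
    rw [edgeProd, hf, eval_prod, map_prod]
    refine Finset.prod_congr rfl fun e _ => ?_
    congr 1
    simp only [hg, eval_add, eval_mul, eval_C, eval_pow, eval_X]
    ring
  simp_rw [e]
  refine h.trans (le_of_eq ?_)
  push_cast
  ring

/-- For edges `e ≠ e₀`, the tuples with `a i * a j = a i₀ * a j₀` (where `e = (i, j)` and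
`e₀ = (i₀, j₀)`), or with `a i₀ * a j₀ = 0`, have codimension one. -/
theorem card_mul_card_degenerate_le [Fintype ι] [LinearOrder ι] {E : Finset (ι × ι)}
    (hE : ∀ e ∈ E, e.1 < e.2) {e₀ : ι × ι} (he₀ : e₀ ∈ E) :
    Fintype.card F * (Finset.univ.filter fun a : ι → F =>
        a e₀.1 * a e₀.2 = 0 ∨ ∃ e ∈ E, e ≠ e₀ ∧ a e.1 * a e.2 = a e₀.1 * a e₀.2).card
      ≤ (2 + E.card) * Fintype.card F ^ Fintype.card ι := by
  have h0 := hE e₀ he₀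
  have hgraph : ∀ e ∈ E, ∃ u, ∃ g : (ι → F) → F, (∀ a x, g (Function.update a u x) = g a) ∧
      (e ≠ e₀ → ∀ a, a e₀.1 * a e₀.2 ≠ 0 → a e.1 * a e.2 = a e₀.1 * a e₀.2 → a u = g a) := by
    intro e he
    have h1 := hE e he
    by_cases heq : e = e₀
    · exact ⟨e₀.1, fun _ => 0, fun _ _ => rfl, fun h => absurd heq h⟩
    have h2 : ¬ (e.1 = e₀.1 ∧ e.2 = e₀.2) := fun h => heq (Prod.ext h.1 h.2)
    by_cases hu : e.1 ≠ e₀.1 ∧ e.2 ≠ e₀.1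
    · refine ⟨e₀.1, fun a => a e.1 * a e.2 / a e₀.2, fun a x => ?_, fun _ a ha h => ?_⟩
      · simp only [Function.update_of_ne hu.1, Function.update_of_ne hu.2,
          Function.update_of_ne h0.ne']
      · rw [eq_div_iff (right_ne_zero_of_mul ha), h]
    · have hu' : e.1 ≠ e₀.2 ∧ e.2 ≠ e₀.2 := by
        constructor <;> intro h4 <;> grind
      refine ⟨e₀.2, fun a => a e.1 * a e.2 / a e₀.1, fun a x => ?_, fun _ a ha h => ?_⟩
      · simp only [Function.update_of_ne hu'.1, Function.update_of_ne hu'.2,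
          Function.update_of_ne h0.ne]
      · rw [eq_div_iff (left_ne_zero_of_mul ha), h, mul_comm]
  have : Nonempty ι := ⟨e₀.1⟩
  choose! u g hg hug using hgraph
  set A : Finset (ι → F) := Finset.univ.filter fun a => a e₀.1 = 0 with hA
  set B : Finset (ι → F) := Finset.univ.filter fun a => a e₀.2 = 0 with hB
  set G : ι × ι → Finset (ι → F) := fun e => Finset.univ.filter fun a => a (u e) = g e a with hG
  have hsub : (Finset.univ.filter fun a : ι → F =>
      a e₀.1 * a e₀.2 = 0 ∨ ∃ e ∈ E, e ≠ e₀ ∧ a e.1 * a e.2 = a e₀.1 * a e₀.2)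
      ⊆ (A ∪ B) ∪ E.biUnion G := by
    intro a ha
    simp only [Finset.mem_filter, Finset.mem_univ, true_and] at ha
    simp only [hA, hB, hG, Finset.mem_union, Finset.mem_biUnion, Finset.mem_filter,
      Finset.mem_univ, true_and]
    by_cases hz : a e₀.1 * a e₀.2 = 0
    · exact Or.inl (mul_eq_zero.1 hz)
    · obtain ⟨e, he, hne, h⟩ := ha.resolve_left hz
      exact Or.inr ⟨e, he, hug e he hne a hz h⟩
  have hAcard := card_mul_card_filter_eq (F := F) e₀.1 (fun _ => 0) fun _ _ => rfl
  have hBcard := card_mul_card_filter_eq (F := F) e₀.2 (fun _ => 0) fun _ _ => rfl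
  calc _ ≤ Fintype.card F * ((A.card + B.card) + ∑ e ∈ E, (G e).card) := by
        refine Nat.mul_le_mul_left _ ((Finset.card_le_card hsub).trans ?_)
        refine (Finset.card_union_le _ _).trans (add_le_add (Finset.card_union_le _ _) ?_)
        exact Finset.card_biUnion_le
    _ = (2 + E.card) * Fintype.card F ^ Fintype.card ι := by
        rw [mul_add, mul_add, hAcard, hBcard, Finset.mul_sum,
          Finset.sum_congr rfl fun e he => card_mul_card_filter_eq (u e) (g e) (hg e he)]
        rw [Finset.sum_const, smul_eq_mul]
        ring

/-- The mean square of the sum over a dilation parameter is `O(q)`. -/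
theorem card_mul_sum_sq_sum_edgeProd_smul_le [Fintype ι] [LinearOrder ι] (hF : ringChar F ≠ 2)
    {r : F} (hr : r ≠ 0) {E : Finset (ι × ι)} (hE : ∀ e ∈ E, e.1 < e.2) (hne : E.Nonempty) :
    (Fintype.card F : ℤ) * ∑ a : ι → F, (∑ t : F, edgeProd r E (fun i => t * a i)) ^ 2
      ≤ ((24 * E.card + 15) ^ 2 + (2 + E.card)) *
        ((Fintype.card F : ℤ) ^ 2 * (Fintype.card F : ℤ) ^ Fintype.card ι) := by
  obtain ⟨e₀, he₀⟩ := hne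
  set q : ℤ := (Fintype.card F : ℤ) with hq
  have hq0 : 0 ≤ q := by positivity
  set bad : Finset (ι → F) := Finset.univ.filter fun a : ι → F =>
    a e₀.1 * a e₀.2 = 0 ∨ ∃ e ∈ E, e ≠ e₀ ∧ a e.1 * a e.2 = a e₀.1 * a e₀.2 with hbad
  have hpt : ∀ a : ι → F, (∑ t : F, edgeProd r E (fun i => t * a i)) ^ 2
      ≤ (24 * E.card + 15) ^ 2 * q + if a ∈ bad then q ^ 2 else 0 := by
    intro a
    split_ifs with h
    · have h1 : |∑ t : F, edgeProd r E (fun i => t * a i)| ≤ q := by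
        refine (Finset.abs_sum_le_sum_abs _ _).trans ?_
        refine (Finset.sum_le_card_nsmul _ _ 1 fun t _ => abs_edgeProd_le_one _ _ _).trans ?_
        simp [hq]
      have h2 := sq_le_sq' (abs_le.1 h1).1 (abs_le.1 h1).2
      have h3 : 0 ≤ (24 * (E.card : ℤ) + 15) ^ 2 * q := by positivity
      linarith
    · simp only [hbad, Finset.mem_filter, Finset.mem_univ, true_and, not_or, not_exists,
        not_and] at h
      rw [add_zero]
      exact sq_sum_edgeProd_smul_le hF hr he₀ h.1 h.2
  have hcard : q * (bad.card : ℤ) ≤ (2 + E.card) * q ^ Fintype.card ι := by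
    have h := card_mul_card_degenerate_le (F := F) hE he₀
    rw [hq]
    exact_mod_cast h
  calc q * ∑ a : ι → F, (∑ t : F, edgeProd r E (fun i => t * a i)) ^ 2
      ≤ q * ∑ a : ι → F, ((24 * E.card + 15) ^ 2 * q + if a ∈ bad then q ^ 2 else 0) :=
        mul_le_mul_of_nonneg_left (Finset.sum_le_sum fun a _ => hpt a) hq0
    _ = (24 * E.card + 15) ^ 2 * (q ^ 2 * q ^ Fintype.card ι) + q ^ 2 * (q * bad.card) := by
        rw [Finset.sum_add_distrib, Finset.sum_const, Finset.sum_ite_mem, Finset.univ_inter,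
          Finset.sum_const, Finset.card_univ, Fintype.card_fun]
        simp only [nsmul_eq_mul, Nat.cast_pow, ← hq]
        ring
    _ ≤ (24 * E.card + 15) ^ 2 * (q ^ 2 * q ^ Fintype.card ι)
          + q ^ 2 * ((2 + E.card) * q ^ Fintype.card ι) := by gcongr
    _ = _ := by ring

/-- The dilation trick: if every edge of `E₁` contains `v` and no edge of `E₂` does, then
`a ↦ (t * a u, a v / t)` preserves the product over `E₁`, and dilates the arguments of the one
over `E₂`. -/
theorem sum_edgeProd_mul_edgeProd_smul [Fintype ι] [LinearOrder ι] (r : F)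
    {E₁ E₂ : Finset (ι × ι)} {v : ι} (h₁ : ∀ e ∈ E₁, e.1 < e.2)
    (hv₁ : ∀ e ∈ E₁, e.1 = v ∨ e.2 = v) (hv₂ : ∀ e ∈ E₂, e.1 ≠ v ∧ e.2 ≠ v) {t : F} (ht : t ≠ 0) :
    ∑ a : ι → F, edgeProd r E₁ a * edgeProd r E₂ (fun i => t * a i)
      = ∑ a : ι → F, edgeProd r E₁ a * edgeProd r E₂ a := by
  let φ : (ι → F) ≃ (ι → F) :=
    Equiv.piCongrRight fun u => Equiv.mulLeft₀ (if u = v then t⁻¹ else t)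
      (by split_ifs <;> simp [ht])
  have hφ : ∀ a u, φ a u = (if u = v then t⁻¹ else t) * a u := fun a u => rfl
  rw [← Equiv.sum_comp φ fun a => edgeProd r E₁ a * edgeProd r E₂ a]
  refine Finset.sum_congr rfl fun a _ => ?_
  congr 1
  · refine edgeProd_congr r fun e he => ?_
    have hlt := h₁ e he
    rw [hφ, hφ]
    rcases hv₁ e he with h | h
    · rw [if_pos h, if_neg (h ▸ hlt.ne')]
      field_simp
    · rw [if_neg (h ▸ hlt.ne), if_pos h]
      field_simp
  · refine edgeProd_congr r fun e he => ?_
    rw [hφ, hφ, if_neg (hv₂ e he).1, if_neg (hv₂ e he).2]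

/-- The Cauchy–Schwarz inequality, for two functions of bounded mean square. -/
theorem abs_mul_sum_mul_le {α : Type*} [Fintype α] {T B : α → ℤ} {q c N : ℤ} (hc : 1 ≤ c)
    (hq : 0 ≤ q) (hN : 0 ≤ N) (hT : q * ∑ a, T a ^ 2 ≤ 2 * q ^ 2 * N)
    (hB : q * ∑ a, B a ^ 2 ≤ c * (q ^ 2 * N)) :
    |q * ∑ a, T a * B a| ≤ 2 * c * (q ^ 2 * N) := by
  refine abs_le_of_sq_le_sq ?_ (by positivity)
  have hB0 : 0 ≤ q * ∑ a, B a ^ 2 := mul_nonneg hq (Finset.sum_nonneg fun _ _ => sq_nonneg _)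
  calc (q * ∑ a, T a * B a) ^ 2 = q ^ 2 * (∑ a, T a * B a) ^ 2 := by ring
    _ ≤ q ^ 2 * ((∑ a, T a ^ 2) * ∑ a, B a ^ 2) :=
        mul_le_mul_of_nonneg_left (Finset.sum_mul_sq_le_sq_mul_sq _ _ _) (sq_nonneg q)
    _ = (q * ∑ a, T a ^ 2) * (q * ∑ a, B a ^ 2) := by ring
    _ ≤ (2 * q ^ 2 * N) * (c * (q ^ 2 * N)) := mul_le_mul hT hB hB0 (by positivity)
    _ = (2 * c) * 1 * (q ^ 2 * N) ^ 2 := by ring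
    _ ≤ (2 * c) * (2 * c) * (q ^ 2 * N) ^ 2 := by gcongr; omega
    _ = _ := by ring

/-- The case of at least two edges: with `v` on one edge but not on another, dilation turns the
sum into the inner product of two functions of mean square `O(q)`. -/
theorem card_mul_abs_sum_edgeProd_le_of_vertex [Fintype ι] [LinearOrder ι]
    (hF : ringChar F ≠ 2) {r : F} (hr : r ≠ 0) {E : Finset (ι × ι)} (hE : ∀ e ∈ E, e.1 < e.2)
    {v : ι} (h₁ : ∃ e ∈ E, e.1 = v ∨ e.2 = v) (h₂ : ∃ e ∈ E, ¬ (e.1 = v ∨ e.2 = v)) :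
    (Fintype.card F : ℤ) * |∑ a : ι → F, edgeProd r E a|
      ≤ 2 * (2 * ((24 * E.card + 15) ^ 2 + (2 + E.card)) + 1) *
        (Fintype.card F : ℤ) ^ Fintype.card ι := by
  set q : ℤ := (Fintype.card F : ℤ) with hq
  have hq2 : 2 ≤ q := by
    have h := Fintype.one_lt_card (α := F)
    omega
  set E₁ := E.filter fun e => e.1 = v ∨ e.2 = v with hE₁
  set E₂ := E.filter fun e => ¬ (e.1 = v ∨ e.2 = v) with hE₂
  have hv₁ : ∀ e ∈ E₁, e.1 = v ∨ e.2 = v := fun e he => (Finset.mem_filter.1 he).2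
  have hv₂ : ∀ e ∈ E₂, e.1 ≠ v ∧ e.2 ≠ v := fun e he => not_or.1 (Finset.mem_filter.1 he).2
  have hlt₁ : ∀ e ∈ E₁, e.1 < e.2 := fun e he => hE e (Finset.mem_filter.1 he).1
  have hlt₂ : ∀ e ∈ E₂, e.1 < e.2 := fun e he => hE e (Finset.mem_filter.1 he).1
  have hne₁ : E₁.Nonempty := by
    obtain ⟨e, he, h⟩ := h₁
    exact ⟨e, Finset.mem_filter.2 ⟨he, h⟩⟩
  have hne₂ : E₂.Nonempty := by
    obtain ⟨e, he, h⟩ := h₂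
    exact ⟨e, Finset.mem_filter.2 ⟨he, h⟩⟩
  have hcard₂ : (E₂.card : ℤ) ≤ E.card := by exact_mod_cast Finset.card_filter_le _ _
  set n := Fintype.card ι with hn
  set S := ∑ a : ι → F, edgeProd r E a with hS
  have hSprod : S = ∑ a : ι → F, edgeProd r E₁ a * edgeProd r E₂ a :=
    Finset.sum_congr rfl fun a _ => (Finset.prod_filter_mul_prod_filter_not E _ _).symm
  set T : (ι → F) → ℤ := fun a => ∑ x, edgeProd r E₁ (Function.update a v x) with hT
  set B : (ι → F) → ℤ := fun a => ∑ t : F, edgeProd r E₂ (fun i => t * a i) with hB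
  have hBv : ∀ a x, B (Function.update a v x) = B a := fun a x =>
    Finset.sum_congr rfl fun t _ => edgeProd_congr r fun e he => by
      rw [Function.update_of_ne (hv₂ e he).1, Function.update_of_ne (hv₂ e he).2]
  -- The term `t = 0` of `B`, which the dilation trick does not cover.
  set S₀ := ∑ a : ι → F, edgeProd r E₁ a * edgeProd r E₂ (fun i => (0 : F) * a i) with hS₀
  have hdil : ∑ a, edgeProd r E₁ a * B a = (q - 1) * S + S₀ := by
    simp only [hB, Finset.mul_sum]
    rw [Finset.sum_comm, ← Finset.sum_erase_add _ _ (Finset.mem_univ (0 : F))]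
    congr 1
    rw [Finset.sum_congr rfl fun t ht => (sum_edgeProd_mul_edgeProd_smul r hlt₁ hv₁ hv₂
      (Finset.mem_erase.1 ht).1).trans hSprod.symm]
    rw [Finset.sum_const, Finset.card_erase_of_mem (Finset.mem_univ _), Finset.card_univ,
      nsmul_eq_mul, Nat.cast_sub Fintype.card_pos, Nat.cast_one]
  have hTB : q * ∑ a, edgeProd r E₁ a * B a = ∑ a, T a * B a := by
    rw [hq, card_mul_sum_eq_sum_sum_update v]
    refine Finset.sum_congr rfl fun a _ => ?_
    simp only [hBv, hT, Finset.sum_mul]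
  have hS₀le : |S₀| ≤ q ^ n := by
    refine (Finset.abs_sum_le_sum_abs _ _).trans ?_
    refine (Finset.sum_le_card_nsmul _ _ 1 fun a _ => ?_).trans ?_
    · rw [abs_mul]
      exact mul_le_one₀ (abs_edgeProd_le_one _ _ _) (abs_nonneg _) (abs_edgeProd_le_one _ _ _)
    · rw [Finset.card_univ, Fintype.card_fun, nsmul_eq_mul, mul_one, Nat.cast_pow]
  set c : ℤ := (24 * E.card + 15) ^ 2 + (2 + E.card) with hc
  have hc1 : 1 ≤ c := by
    have h := sq_nonneg (24 * (E.card : ℤ) + 15)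
    have h' : (0 : ℤ) ≤ E.card := Int.natCast_nonneg _
    linarith
  have hT2 : q * ∑ a, T a ^ 2 ≤ 2 * q ^ 2 * q ^ n :=
    card_mul_sum_sq_sum_edgeProd_le hF hr hlt₁ hv₁ hne₁
  have hB2 : q * ∑ a, B a ^ 2 ≤ c * (q ^ 2 * q ^ n) := by
    refine (card_mul_sum_sq_sum_edgeProd_smul_le hF hr hlt₂ hne₂).trans ?_
    rw [hc]
    gcongr
  have hCS := abs_mul_sum_mul_le hc1 (by omega : 0 ≤ q) (by positivity : 0 ≤ q ^ n) hT2 hB2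
  rw [← hTB, hdil] at hCS
  have hq0 : 0 < q := by omega
  have h1 : q * (q * ((q - 1) * |S|)) ≤ q * (q * ((2 * c + 1) * q ^ n)) := by
    have e : q * (q * ((q - 1) * S)) = q * (q * ((q - 1) * S + S₀)) - q * (q * S₀) := by ring
    calc q * (q * ((q - 1) * |S|)) = |q * (q * ((q - 1) * S))| := by
          rw [abs_mul, abs_mul, abs_mul, abs_of_pos hq0, abs_of_nonneg (by omega : 0 ≤ q - 1)]
      _ ≤ |q * (q * ((q - 1) * S + S₀))| + |q * (q * S₀)| := by rw [e]; exact abs_sub _ _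
      _ ≤ 2 * c * (q ^ 2 * q ^ n) + q * (q * q ^ n) := by
          refine add_le_add hCS ?_
          rw [abs_mul, abs_mul, abs_of_pos hq0]
          gcongr
      _ = _ := by ring
  have h2 : (q - 1) * |S| ≤ (2 * c + 1) * q ^ n :=
    le_of_mul_le_mul_left (le_of_mul_le_mul_left h1 hq0) hq0
  have h3 : q * |S| ≤ (2 * (q - 1)) * |S| := by gcongr; omega
  linarith

/-- The character sum of a nonempty graph is smaller than trivial by a full factor `q`. -/
theorem card_mul_abs_sum_edgeProd_le [Fintype ι] [LinearOrder ι]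
    (hF : ringChar F ≠ 2) {r : F} (hr : r ≠ 0) {E : Finset (ι × ι)} (hE : ∀ e ∈ E, e.1 < e.2)
    (hne : E.Nonempty) :
    (Fintype.card F : ℤ) * |∑ a : ι → F, edgeProd r E a|
      ≤ 2 * (2 * ((24 * E.card + 15) ^ 2 + (2 + E.card)) + 1) *
        (Fintype.card F : ℤ) ^ Fintype.card ι := by
  obtain ⟨e, he⟩ := hne
  have h0 := hE e he
  by_cases hE1 : ∃ e' ∈ E, e' ≠ e
  · obtain ⟨e', he', hne⟩ := hE1
    have h1 := hE e' he'
    have h2 : ¬ (e'.1 = e.1 ∧ e'.2 = e.2) := fun h => hne (Prod.ext h.1 h.2)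
    by_cases hv : e.1 = e'.1 ∨ e.2 = e'.1
    · exact card_mul_abs_sum_edgeProd_le_of_vertex hF hr hE (v := e'.2) ⟨e', he', Or.inr rfl⟩
        ⟨e, he, by grind⟩
    · exact card_mul_abs_sum_edgeProd_le_of_vertex hF hr hE (v := e'.1) ⟨e', he', Or.inl rfl⟩
        ⟨e, he, hv⟩
  · -- A single edge `(i, j)`: the sum over `a j` vanishes unless `a i = 0`.
    push Not at hE1
    have hEe : E = {e} := Finset.eq_singleton_iff_unique_mem.2 ⟨he, hE1⟩
    set q : ℤ := (Fintype.card F : ℤ) with hq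
    have hq0 : 0 ≤ q := by positivity
    have hpt : ∀ a : ι → F, |∑ y, edgeProd r E (Function.update a e.2 y)|
        ≤ q * if a e.1 = 0 then 1 else 0 := by
      intro a
      simp only [edgeProd, hEe, Finset.prod_singleton, Function.update_self,
        Function.update_of_ne h0.ne]
      split_ifs with h
      · refine (Finset.abs_sum_le_sum_abs _ _).trans ?_
        refine (Finset.sum_le_card_nsmul _ _ 1 fun t _ => abs_quadraticChar_le_one _).trans ?_
        simp [hq]
      · rw [sum_quadraticChar_mul_add hF h]
        simp
    have hcard : q * ((Finset.univ.filter fun a : ι → F => a e.1 = 0).card : ℤ)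
        = q ^ Fintype.card ι := by
      have h := card_mul_card_filter_eq (F := F) e.1 (fun _ => 0) fun _ _ => rfl
      rw [hq]
      exact_mod_cast h
    have h : q * |∑ a : ι → F, edgeProd r E a| ≤ q ^ Fintype.card ι := by
      rw [← abs_of_nonneg hq0, ← abs_mul, abs_of_nonneg hq0, hq,
        card_mul_sum_eq_sum_sum_update e.2, ← hq]
      refine (Finset.abs_sum_le_sum_abs _ _).trans ((Finset.sum_le_sum fun a _ => hpt a).trans ?_)
      rw [← Finset.mul_sum, Finset.sum_boole, hcard]
    refine h.trans (le_mul_of_one_le_left (by positivity) ?_)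
    have : (0 : ℤ) ≤ (24 * E.card + 15) ^ 2 := by positivity
    omega

end CharSums

/-! ### Counting Diophantine tuples -/

/-- The edges of the complete graph on `m` vertices, each oriented from its smaller end. -/
def completeEdges (m : ℕ) : Finset (Fin m × Fin m) := {e | e.1 < e.2}

theorem mem_completeEdges {m : ℕ} {e : Fin m × Fin m} : e ∈ completeEdges m ↔ e.1 < e.2 := by
  simp [completeEdges]

theorem card_completeEdges (m : ℕ) : (completeEdges m).card = m * (m - 1) / 2 := by
  rw [completeEdges, Finset.card_filter, Fintype.sum_prod_type]
  have h : ∀ i : Fin m, (∑ j : Fin m, if i < j then 1 else 0) = m - 1 - (i : ℕ) := fun i => by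
    rw [← Finset.card_filter, Finset.filter_lt_eq_Ioi, Fin.card_Ioi]
  simp only [h]
  rw [Fin.sum_univ_eq_sum_range fun i => m - 1 - i, Finset.sum_range_reflect (fun i => i),
    Finset.sum_range_id]

section Counting

variable {F : Type*} [Field F] [Fintype F] [DecidableEq F] {m : ℕ}

theorem card_mul_card_mul_add_eq_zero_le {r : F} (hr : r ≠ 0) {e : Fin m × Fin m}
    (he : e.1 < e.2) :
    Fintype.card F * (Finset.univ.filter fun a : Fin m → F => a e.1 * a e.2 + r = 0).card
      ≤ Fintype.card F ^ m := by
  have h := card_mul_card_filter_eq (F := F) e.1 (fun a : Fin m → F => -r / a e.2) fun a x => by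
    rw [Function.update_of_ne he.ne']
  rw [Fintype.card_fin] at h
  refine le_trans (Nat.mul_le_mul_left _ (Finset.card_le_card fun a ha => ?_)) h.le
  simp only [Finset.mem_filter, Finset.mem_univ, true_and] at ha ⊢
  have h2 : a e.2 ≠ 0 := by
    intro h0
    rw [h0, mul_zero, zero_add] at ha
    exact hr ha
  rw [eq_div_iff h2]
  exact eq_neg_of_add_eq_zero_left ha

open Classical in
/-- The indicator function of Diophantine tuples against its expansion in characters; they differ
only where some `a i * a j + r` vanishes. -/
theorem abs_indicator_sub_prod_le (r : F) (a : Fin m → F) :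
    |2 ^ (completeEdges m).card * (if IsDiophantineTuple r a then 1 else 0)
        - ∏ e ∈ completeEdges m, (1 + quadraticChar F (a e.1 * a e.2 + r))|
      ≤ 2 ^ (completeEdges m).card *
        ∑ e ∈ completeEdges m, if a e.1 * a e.2 + r = 0 then (1 : ℤ) else 0 := by
  have hfac : ∀ e : Fin m × Fin m, 0 ≤ 1 + quadraticChar F (a e.1 * a e.2 + r) ∧
      1 + quadraticChar F (a e.1 * a e.2 + r) ≤ 2 := fun e => by
    have := abs_le.1 (abs_quadraticChar_le_one (a e.1 * a e.2 + r))
    constructor <;> linarith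
  have hsum0 : ∀ e ∈ completeEdges m,
      (0 : ℤ) ≤ if a e.1 * a e.2 + r = 0 then (1 : ℤ) else 0 := fun e _ => by
    split_ifs <;> norm_num
  by_cases hz : ∃ e ∈ completeEdges m, a e.1 * a e.2 + r = 0
  · obtain ⟨e, he, h0⟩ := hz
    have h1 : (1 : ℤ) ≤ ∑ e ∈ completeEdges m, if a e.1 * a e.2 + r = 0 then (1 : ℤ) else 0 := by
      have := Finset.single_le_sum hsum0 he
      rwa [if_pos h0] at this
    have h2 : ∏ e ∈ completeEdges m, (1 + quadraticChar F (a e.1 * a e.2 + r))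
        ≤ 2 ^ (completeEdges m).card :=
      (Finset.prod_le_prod (fun e _ => (hfac e).1) fun e _ => (hfac e).2).trans_eq
        (Finset.prod_const 2)
    have h3 : 0 ≤ ∏ e ∈ completeEdges m, (1 + quadraticChar F (a e.1 * a e.2 + r)) :=
      Finset.prod_nonneg fun e _ => (hfac e).1
    refine le_trans ?_ (le_mul_of_one_le_right (by positivity) h1)
    have h4 : (0 : ℤ) < 2 ^ (completeEdges m).card := by positivity
    rw [abs_le]
    split_ifs <;> constructor <;> linarith
  · push Not at hz
    have h : (2 ^ (completeEdges m).card * (if IsDiophantineTuple r a then 1 else 0) : ℤ)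
        = ∏ e ∈ completeEdges m, (1 + quadraticChar F (a e.1 * a e.2 + r)) := by
      split_ifs with hd
      · rw [mul_one, ← Finset.prod_const]
        refine Finset.prod_congr rfl fun e he => ?_
        rw [(quadraticChar_one_iff_isSquare (hz e he)).2 (hd _ _ (mem_completeEdges.1 he))]
        norm_num
      · rw [IsDiophantineTuple] at hd
        push Not at hd
        obtain ⟨i, j, hij, hns⟩ := hd
        rw [mul_zero, eq_comm]
        refine Finset.prod_eq_zero (i := (i, j)) (mem_completeEdges.2 hij) ?_
        rw [quadraticChar_neg_one_iff_not_isSquare.2 hns]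
        norm_num
    rw [h, sub_self, abs_zero]
    exact mul_nonneg (by positivity) (Finset.sum_nonneg hsum0)

theorem card_mul_abs_two_pow_mul_numDiophantineTuples_sub_sum_le {r : F} (hr : r ≠ 0) :
    (Fintype.card F : ℤ) * |2 ^ (completeEdges m).card * (numDiophantineTuples r m : ℤ)
        - ∑ a : Fin m → F, ∏ e ∈ completeEdges m, (1 + quadraticChar F (a e.1 * a e.2 + r))|
      ≤ 2 ^ (completeEdges m).card * ((completeEdges m).card : ℤ) * (Fintype.card F : ℤ) ^ m := by
  classical
  have hN : (numDiophantineTuples r m : ℤ)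
      = ∑ a : Fin m → F, if IsDiophantineTuple r a then 1 else 0 := by
    rw [numDiophantineTuples, Set.ncard_eq_toFinset_card', Set.toFinset_ofPred, Finset.sum_boole]
  have h1 : |2 ^ (completeEdges m).card * (numDiophantineTuples r m : ℤ)
      - ∑ a : Fin m → F, ∏ e ∈ completeEdges m, (1 + quadraticChar F (a e.1 * a e.2 + r))|
      ≤ 2 ^ (completeEdges m).card * ∑ e ∈ completeEdges m,
        ((Finset.univ.filter fun a : Fin m → F => a e.1 * a e.2 + r = 0).card : ℤ) := by
    rw [hN, Finset.mul_sum, ← Finset.sum_sub_distrib]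
    refine (Finset.abs_sum_le_sum_abs _ _).trans
      ((Finset.sum_le_sum fun a _ => abs_indicator_sub_prod_le r a).trans (le_of_eq ?_))
    rw [← Finset.mul_sum, Finset.sum_comm]
    simp only [Finset.sum_boole]
  have h2 : ∀ e ∈ completeEdges m, (Fintype.card F : ℤ) *
      ((Finset.univ.filter fun a : Fin m → F => a e.1 * a e.2 + r = 0).card : ℤ)
        ≤ (Fintype.card F : ℤ) ^ m := by
    intro e he
    have h := card_mul_card_mul_add_eq_zero_le hr (mem_completeEdges.1 he)
    exact_mod_cast h
  refine (mul_le_mul_of_nonneg_left h1 (Int.natCast_nonneg _)).trans ?_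
  rw [mul_left_comm, mul_assoc, Finset.mul_sum]
  refine mul_le_mul_of_nonneg_left ((Finset.sum_le_sum h2).trans_eq ?_) (by positivity)
  rw [Finset.sum_const, nsmul_eq_mul]

/-- The constant in the error term: a contribution of the zeros of the `a i * a j + r`, and one
of each nonempty graph. -/
def errorConst (m : ℕ) : ℤ :=
  2 ^ (completeEdges m).card * ((completeEdges m).card : ℤ)
    + ∑ E ∈ (completeEdges m).powerset.erase ∅,
      2 * (2 * ((24 * (E.card : ℤ) + 15) ^ 2 + (2 + (E.card : ℤ))) + 1)

theorem card_mul_abs_two_pow_mul_numDiophantineTuples_sub_le (hF : ringChar F ≠ 2) {r : F}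
    (hr : r ≠ 0) :
    (Fintype.card F : ℤ) * |2 ^ (completeEdges m).card * (numDiophantineTuples r m : ℤ)
        - (Fintype.card F : ℤ) ^ m|
      ≤ errorConst m * (Fintype.card F : ℤ) ^ m := by
  set P := completeEdges m with hP
  have hq0 : (0 : ℤ) ≤ Fintype.card F := Int.natCast_nonneg _
  have hexp : ∑ a : Fin m → F, ∏ e ∈ P, (1 + quadraticChar F (a e.1 * a e.2 + r))
      = (Fintype.card F : ℤ) ^ m
        + ∑ E ∈ P.powerset.erase ∅, ∑ a : Fin m → F, edgeProd r E a := by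
    simp_rw [Finset.prod_one_add]
    rw [Finset.sum_comm, ← Finset.add_sum_erase _ _ (Finset.empty_mem_powerset P)]
    congr 1
    simp
  have hdiff := card_mul_abs_two_pow_mul_numDiophantineTuples_sub_sum_le (m := m) hr
  have hE : (Fintype.card F : ℤ) * |∑ E ∈ P.powerset.erase ∅, ∑ a : Fin m → F, edgeProd r E a|
      ≤ (∑ E ∈ P.powerset.erase ∅,
          2 * (2 * ((24 * (E.card : ℤ) + 15) ^ 2 + (2 + (E.card : ℤ))) + 1))
        * (Fintype.card F : ℤ) ^ m := by
    refine (mul_le_mul_of_nonneg_left (Finset.abs_sum_le_sum_abs _ _) hq0).trans ?_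
    rw [Finset.mul_sum, Finset.sum_mul]
    refine Finset.sum_le_sum fun E hE => ?_
    rw [Finset.mem_erase, Finset.mem_powerset] at hE
    have h := card_mul_abs_sum_edgeProd_le hF hr (fun e he => mem_completeEdges.1 (hE.2 he))
      (Finset.nonempty_iff_ne_empty.2 hE.1)
    rwa [Fintype.card_fin] at h
  rw [errorConst, add_mul]
  refine le_trans ?_ (add_le_add hdiff hE)
  rw [← mul_add]
  refine mul_le_mul_of_nonneg_left ?_ hq0
  rw [← hP, hexp]
  refine le_trans (le_of_eq ?_) (abs_add_le _ _)
  congr 1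
  ring

end Counting

theorem theorem1p1 (m : ℕ) (hm : 4 ≤ m) :
    ∃ C : ℝ, ∀ q : ℕ, IsPrimePow q → Odd q →
      ∀ (F : Type*) [Field F] [Finite F], Nat.card F = q →
        ∀ r : F, r ≠ 0 →
          |(numDiophantineTuples r m : ℝ) - (q : ℝ) ^ m / 2 ^ (m * (m - 1) / 2)|
            ≤ C * (q : ℝ) ^ (m - 1) := by
  refine ⟨(errorConst m : ℝ), ?_⟩
  intro q _ hodd F _ _ hcard r hr
  classical
  have := Fintype.ofFinite F
  rw [Nat.card_eq_fintype_card] at hcard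
  have hF : ringChar F ≠ 2 := by
    intro h
    have h1 := FiniteField.even_card_of_char_two h
    rw [hcard] at h1
    have h2 := Nat.odd_iff.1 hodd
    omega
  have hq : (0 : ℝ) < q := by
    have := Fintype.card_pos (α := F)
    exact_mod_cast hcard ▸ this
  have h := card_mul_abs_two_pow_mul_numDiophantineTuples_sub_le (m := m) hF hr
  rw [hcard] at h
  have h' : (q : ℝ) * |2 ^ (completeEdges m).card * (numDiophantineTuples r m : ℝ) - (q : ℝ) ^ m|
      ≤ errorConst m * (q : ℝ) ^ m := by exact_mod_cast h
  rw [card_completeEdges] at h'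
  set t : ℝ := 2 ^ (m * (m - 1) / 2) with ht
  have ht1 : 1 ≤ t := one_le_pow₀ (by norm_num)
  refine le_of_mul_le_mul_left (le_trans ?_ (h'.trans (le_of_eq ?_))) hq
  · refine mul_le_mul_of_nonneg_left ?_ hq.le
    have e : t * (numDiophantineTuples r m : ℝ) - (q : ℝ) ^ m
        = t * ((numDiophantineTuples r m : ℝ) - (q : ℝ) ^ m / t) := by
      have : t ≠ 0 := by positivity
      field_simp
    rw [e, abs_mul, abs_of_pos (by positivity : 0 < t)]
    exact le_mul_of_one_le_left (abs_nonneg _) ht1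
  · obtain ⟨k, rfl⟩ : ∃ k, m = k + 1 := ⟨m - 1, by omega⟩
    rw [Nat.add_sub_cancel, pow_succ]
    ring
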